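/- **Model.** An odd number $T$ of agents vote between two alternatives $\mathbf A$ and $\mathbf R$. The world $W\in\{L,H\}$ has a commonly known prior with $P_L,P_H>0$. Given $W=n$, the agents receive independent signals in $\{\ell,h\}$, each equal to $m$ with probability $P_{mn}$, where $P_{\ell L}>P_{\ell H}$ and $P_{hH}>P_{hL}$. Each agent has a type in $\{F,U,C\}$, and an agent of type $k$ has utility $v_k(n,a)\in\{0,\dots,B\}$ when $a$ is chosen in world $n$. All types satisfy $v_k(H,\mathbf A)>v_k(L,\mathbf A)$ and $v_k(L,\mathbf R)>v_k(H,\mathbf R)$; moreover, candidate-friendly agents satisfy $v_F(H,\mathbf A)>v_F(L,\mathbf A)>v_F(L,\mathbf R)>v_F(H,\mathbf R)$, candidate-unfriendly agents satisfy $v_U(L,\mathbf R)>v_U(H,\mathbf R)>v_U(H,\mathbf A)>v_U(L,\mathbf A)$, and contingent agents satisfy $v_C(L,\mathbf R)>v_C(L,\mathbf A)$ and $v_C(H,\mathbf A)>v_C(H,\mathbf R)$. The vector of type fractions $(\alpha_F,\alpha_U,\alpha_C)$ is not known; it is drawn from a commonly known distribution $\mathcal D$ on the simplex $\Delta_3$.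 Formally, there is a common prior $Q$ on type profiles in $\{F,U,C\}^T$, independent of $W$ and of the signals, under which the vector of type fractions has law $\mathcal D$ (we say that $Q$ is *consistent* with $\mathcal D$). Each agent knows his or her own type and signal. The *environment* consists of $B$, the prior over worlds, the $P_{mn}$, the utilities and $\mathcal D$; it does not depend on $T$. A *mechanism* for $T$ agents asks every agent the same questions and chooses an alternative, possibly at random, from the $T$ reports. It is *anonymous* if permuting the reports does not change the (distribution of the) chosen alternative. A (mixed) strategy of an agent maps type and signal to a distribution over reports; the *truthful* strategy answers each question correctly to the best of the agent's knowledge, i.e. as a function of the common knowledge, the own type and the own signal. Let $u_{t,k}(\Sigma)$ be the expected utility of agent $t$ under the profile $\Sigma$ conditional on $t$ having type $k$ (not conditional on the signal). A profile $\Sigma$ is an *$\varepsilon$-strong Bayes Nash equilibrium* if there are no set $D$ of pairs (agent, type) and profile $\Sigma'$ that agrees with $\Sigma$ for all pairs outside $D$, such that $u_{t,k}(\Sigma')\ge u_{t,k}(\Sigma)$ for all $(t,k)\in D$, and $u_{t,k}(\Sigma')>u_{t,k}(\Sigma)+\varepsilon$ for some $(t,k)\in D$. **Statement.** There exist a constant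 $\tau>0$ and an environment, with consistent priors existing for infinitely many odd $T$, such that for every odd $T$ and every prior $Q$ on $\{F,U,C\}^T$ consistent with $\mathcal D$, no anonymous mechanism for $T$ agents satisfies both of the following: * when all agents are truthful, the mechanism chooses the alternative preferred, in the actual world, by more than half of the agents with probability more than $1-\tau$ (over the world, the types, the signals and the mechanism's randomness); * under the mechanism, the truthful strategy profile is a $\tau$-strong Bayes Nash equilibrium. -/

import Mathlib

open Filter

universe u

noncomputable section

namespace CrowdVoting

/-- The two states of the world: low quality and high quality. -/
inductive World
  | L | H
  deriving DecidableEq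

instance : Fintype World := ⟨{.L, .H}, by intro x; cases x <;> decide⟩

/-- The two private signals: low and high. -/
inductive Signal
  | l | h
  deriving DecidableEq

instance : Fintype Signal := ⟨{.l, .h}, by intro x; cases x <;> decide⟩

/-- The two alternatives: accept and reject. -/
inductive Choice
  | A | R
  deriving DecidableEq

instance : Fintype Choice := ⟨{.A, .R}, by intro x; cases x <;> decide⟩

/-- The three preference types: candidate-friendly, candidate-unfriendly, contingent. -/
inductive AgentType
  | F | U | C
  deriving DecidableEq

instance : Fintype AgentType := ⟨{.F, .U, .C}, by intro x; cases x <;> decide⟩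

open World Signal Choice AgentType

/-- The parameters of the voting model with an unknown distribution of agent types. None of them
depends on the number of agents, and all of them are common knowledge; what the agents do not know
is the vector of type fractions itself, which is drawn from `typeLaw`. -/
structure Environment where
  /-- the upper bound on utilities -/
  B : ℕ
  B_pos : 0 < B
  /-- the common prior over worlds -/
  worldPrior : PMF World
  worldPrior_pos : ∀ w, 0 < worldPrior w
  /-- the distribution of the signal of a single agent in each world -/
  signalLaw : World → PMF Signal
  corr_l : signalLaw H l < signalLaw L l
  corr_h : signalLaw L h < signalLaw H h
  /-- the distribution on the simplex from which the vector of fractions `(α_F, α_U, α_C)`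
  is drawn -/
  typeLaw : PMF (AgentType → ℝ)
  typeLaw_simplex : ∀ α ∈ typeLaw.support, α ∈ stdSimplex ℝ AgentType
  /-- the ex-post utility of an agent of the given type -/
  v : AgentType → World → Choice → ℕ
  v_le : ∀ k w a, v k w a ≤ B
  v_A : ∀ k, v k L A < v k H A
  v_R : ∀ k, v k H R < v k L R
  friendly : v F L A < v F H A ∧ v F L R < v F L A ∧ v F H R < v F L R
  unfriendly : v U H R < v U L R ∧ v U H A < v U H R ∧ v U L A < v U H A
  contingent : v C L A < v C L R ∧ v C H R < v C H A

/-- The vector of fractions of the types in a type profile of `T` agents. -/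
def typeFractions {T : ℕ} (θ : Fin T → AgentType) (k : AgentType) : ℝ :=
  ((Finset.univ.filter fun t => θ t = k).card : ℝ) / T

/-- A common prior `Q` over the type profiles of `T` agents is consistent with the environment if
the vector of type fractions that it induces has law `E.typeLaw`. -/
def Environment.IsTypePrior (E : Environment) {T : ℕ} (Q : PMF (Fin T → AgentType)) : Prop :=
  Q.map typeFractions = E.typeLaw

/-- Everything an agent knows when reporting: the common knowledge (environment and prior over
type profiles), the agent's own type, and the agent's own signal. -/
structure Knowledge (T : ℕ) where
  env : Environment
  prior : PMF (Fin T → AgentType)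
  ownType : AgentType
  ownSignal : Signal

/-- A (possibly randomized) mechanism for `T` agents. It asks every agent the same list of
questions; a question comes with a set of possible answers, and its meaning says which answer is the
correct one, to the best of the knowledge of the agent asked (for instance the own signal, the own
type, or a posterior probability computed from the common prior and the own information).
From the reports of all the agents the mechanism produces a distribution over the two alternatives;
a deterministic mechanism is the case where this is always a point mass. -/
structure Mechanism (T : ℕ) where
  Question : Type u
  Answer : Question → Type u
  correct : (q : Question) → Knowledge T → Answer q
  outcome : (Fin T → (q : Question) → Answer q) → PMF Choice

/-- The space of reports: one answer to each question. -/
abbrev Mechanism.Report {T : ℕ} (M : Mechanism.{u} T) : Type u :=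
  (q : M.Question) → M.Answer q

/-- The outcome depends only on the collection of reports, not on who submits which one. -/
def Mechanism.Anonymous {T : ℕ} (M : Mechanism.{u} T) : Prop :=
  ∀ (r₁ r₂ : Fin T → M.Report), (∃ π : Equiv.Perm (Fin T), r₁ = r₂ ∘ π) →
    M.outcome r₁ = M.outcome r₂

/-- A profile of mixed strategies: for each agent, each type the agent may have and each signal the
agent may receive, a distribution over reports. -/
abbrev Mechanism.Profile {T : ℕ} (M : Mechanism.{u} T) : Type u :=
  Fin T → AgentType → Signal → PMF M.Report

/-- The truthful profile: every agent gives the correct answer to each question. -/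
def Mechanism.truthful {T : ℕ} (M : Mechanism.{u} T) (E : Environment)
    (Q : PMF (Fin T → AgentType)) : M.Profile :=
  fun _ k s => PMF.pure fun q => M.correct q ⟨E, Q, k, s⟩

theorem tsum_prod_pmf {R : Type*} : ∀ {n : ℕ} (p : Fin n → PMF R),
    ∑' f : Fin n → R, ∏ t, p t (f t) = 1 := by
  intro n
  induction n with
  | zero => intro p; simp
  | succ n ih =>
    intro p
    rw [← (Fin.consEquiv fun _ : Fin (n + 1) => R).tsum_eq, ENNReal.tsum_prod']
    simp [Fin.consEquiv, Fin.prod_univ_succ, ENNReal.tsum_mul_left, ih, PMF.tsum_coe]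

/-- The law of independent draws, one from each `p t`. -/
def indep {R : Type*} {n : ℕ} (p : Fin n → PMF R) : PMF (Fin n → R) :=
  ⟨fun f => ∏ t, p t (f t), tsum_prod_pmf p ▸ ENNReal.summable.hasSum⟩

variable {T : ℕ}

/-- The joint law of the world, the type profile and the alternative chosen, when the agents play
`σ`. The world and the type profile are independent; given them the agents draw independent signals
from the law of signals in that world, then each agent draws a report independently. -/
def play (E : Environment) (Q : PMF (Fin T → AgentType)) (M : Mechanism.{u} T) (σ : M.Profile) :
    PMF (World × (Fin T → AgentType) × Choice) :=
  E.worldPrior.bind fun w =>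
  Q.bind fun θ =>
  (indep fun _ : Fin T => E.signalLaw w).bind fun s =>
  (indep fun t => σ t (θ t) (s t)).bind fun r =>
  (M.outcome r).map fun a => (w, θ, a)

/-- Alternative `a` is strictly preferred to the other one by more than half of the agents, when the
world is `w` and the type profile is `θ`. -/
def Environment.IsMajorityWish (E : Environment) (w : World) (θ : Fin T → AgentType)
    (a : Choice) : Prop :=
  T < 2 * (Finset.univ.filter fun t => ∀ b, b ≠ a → E.v (θ t) w b < E.v (θ t) w a).card

open Classical in
/-- The probability that the chosen alternative is the one favored by more than half of the
agents. -/
def majorityProb (E : Environment) (Q : PMF (Fin T → AgentType)) (M : Mechanism.{u} T)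
    (σ : M.Profile) : ℝ :=
  ∑ x : World × (Fin T → AgentType) × Choice,
    if E.IsMajorityWish x.1 x.2.1 x.2.2 then (play E Q M σ x).toReal else 0

/-- The expected utility of agent `t` when having type `k`: the conditional expectation of
`v k` at the world and the alternative chosen, given that `t` has type `k`; the signals are not
conditioned upon. If `t` has type `k` with probability zero, the value is zero for every profile. -/
def utility (E : Environment) (Q : PMF (Fin T → AgentType)) (M : Mechanism.{u} T)
    (σ : M.Profile) (t : Fin T) (k : AgentType) : ℝ :=
  (∑ x : World × (Fin T → AgentType) × Choice,
    if x.2.1 t = k then (play E Q M σ x).toReal * (E.v k x.1 x.2.2 : ℝ) else 0) /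
  (∑ θ : Fin T → AgentType, if θ t = k then (Q θ).toReal else 0)

/-- `σ` is an `ε`-strong Bayes Nash equilibrium: there is no coalition `D` and no profile `σ'` that
differs from `σ` only in `D`, makes every member of `D` at least as well off and some member of
`D` better off by more than `ε`. Agents know their own types, so that a member of a coalition is an
agent together with a type; e.g. the coalition of all the candidate-friendly agents is
`{x | x.2 = F}`. -/
def IsStrongBNE (E : Environment) (Q : PMF (Fin T → AgentType)) (M : Mechanism.{u} T)
    (ε : ℝ) (σ : M.Profile) : Prop :=
  ¬ ∃ (D : Set (Fin T × AgentType)) (σ' : M.Profile),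
    (∀ t k, (t, k) ∉ D → σ' t k = σ t k) ∧
    (∀ t k, (t, k) ∈ D → utility E Q M σ t k ≤ utility E Q M σ' t k) ∧
    (∃ t k, (t, k) ∈ D ∧ utility E Q M σ t k + ε < utility E Q M σ' t k)

end CrowdVoting

end

open CrowdVoting

/-!
The environment `hardEnv` has two equally likely vectors of type fractions: either all the agents
are contingent, or two fifths are candidate-friendly and the others contingent. In the low-quality
world all signals are low; in the high-quality world a signal is high with probability `1 / 5`.
A mechanism that follows the majority has to accept when everybody is contingent and quality is
high, and to reject when the fractions are mixed and quality is low.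

The candidate-friendly agents can blur the two cases by `mimicry`: each of them claims to be
contingent and to hold a signal obtained from a fair coin. Consistent priors exist only if
`T = 5 * j` for some `j`. If the fractions are mixed and quality is low, then all the reports under
mimicry look contingent, and the number of reported high signals is binomial with parameters `2 * j`
and `1 / 2`. A truthful electorate of contingent agents in the high-quality world yields the
binomial law with parameters `5 * j` and `1 / 5`. The former law is pointwise at most twice the
latter, uniformly in `j` (`choose_fair_le_two_mul`). An anonymous mechanism reacts to such reports
only through the number of high signals, so a rejection that is rare for the truthful electorate is
at most twice as likely under mimicry (`reject_mimicry_le`). Thus mimicry turns a very likely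
rejection in the low-quality world into a very likely acceptance. As high quality is unlikely, this
outweighs whatever the mimics may lose in the high-quality world, for every candidate-friendly agent
and every type profile with mixed fractions (`not_good_mechanism`).
-/

noncomputable section

namespace CrowdVoting

open World Signal Choice AgentType
open scoped ENNReal

/-! ### Comparison of two binomial laws with the same mean -/

/-- The probability of the value `j` under the binomial law with parameters `2 * j` and `1 / 2` is
at most `(2 * j + 1) / (j + 1)` times its probability under the binomial law with parameters
`5 * j` and `1 / 5`, up to clearing denominators. The bounded factor `(2 * j + 1) / (j + 1)`
is needed for the induction: the ratio of the two probabilities increases with `j` as well. -/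
theorem choose_mode_le (j : ℕ) :
    (j + 1) * ((2 * j).choose j * 5 ^ (5 * j) * 4 ^ j) ≤
      (2 * j + 1) * ((5 * j).choose j * 4 ^ (6 * j)) := by
  induction j with
  | zero => simp
  | succ j ih =>
    -- the recursions of both binomial coefficients, without denominators
    have h2 : (j + 1) * (2 * (j + 1)).choose (j + 1) = 2 * (2 * j + 1) * (2 * j).choose j := by
      have := Nat.succ_mul_centralBinom_succ j
      simpa [Nat.centralBinom] using this
    have h5 : (4 * j + 1) * (4 * j + 2) * (4 * j + 3) * (4 * (j + 1)) * (j + 1) *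
        (5 * (j + 1)).choose (j + 1) =
        (5 * j + 1) * (5 * j + 2) * (5 * j + 3) * (5 * j + 4) * (5 * (j + 1)) *
          (5 * j).choose j := by
      have e1 : (5 * (j + 1)).choose (j + 1) * (j + 1).factorial * (4 * j + 4).factorial =
          (5 * (j + 1)).factorial := by
        have := Nat.choose_mul_factorial_mul_factorial (show j + 1 ≤ 5 * (j + 1) by omega)
        rwa [show 5 * (j + 1) - (j + 1) = 4 * j + 4 by omega] at this
      have e2 : (5 * j).choose j * j.factorial * (4 * j).factorial = (5 * j).factorial := by
        have := Nat.choose_mul_factorial_mul_factorial (show j ≤ 5 * j by omega)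
        rwa [show 5 * j - j = 4 * j by omega] at this
      rw [show 5 * (j + 1) = 5 * j + 4 + 1 by ring] at e1 ⊢
      simp only [Nat.factorial_succ] at e1
      rw [← e2] at e1
      have hp : 0 < j.factorial * (4 * j).factorial := by positivity
      apply Nat.eq_of_mul_eq_mul_right hp
      linear_combination e1
    set a := (2 * j).choose j
    set a' := (2 * (j + 1)).choose (j + 1)
    set b := (5 * j).choose j
    set b' := (5 * (j + 1)).choose (j + 1)
    rw [show 5 ^ (5 * (j + 1)) = 3125 * 5 ^ (5 * j) by ring,
      show 4 ^ (6 * (j + 1)) = 4096 * 4 ^ (6 * j) by ring, show 4 ^ (j + 1) = 4 * 4 ^ j by ring]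
    set x := 5 ^ (5 * j)
    set y := 4 ^ (6 * j)
    set z := 4 ^ j
    have hpos : 0 < (4 * j + 1) * (4 * j + 2) * (4 * j + 3) * (4 * (j + 1)) * (j + 1) *
        (j + 1) := by
      positivity
    -- after multiplication by the denominators of both recursions, a polynomial inequality is left
    have hpoly : (j + 2) * (2 * (2 * j + 1)) * 12500 *
        ((4 * j + 1) * (4 * j + 2) * (4 * j + 3)) * 4 * (2 * j + 1) ≤
        (2 * j + 3) * 4096 * ((5 * j + 1) * (5 * j + 2) * (5 * j + 3) * (5 * j + 4)) * 5 *
          (j + 1) := by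
      ring_nf
      omega
    refine Nat.le_of_mul_le_mul_left ?_ hpos
    calc (4 * j + 1) * (4 * j + 2) * (4 * j + 3) * (4 * (j + 1)) * (j + 1) * (j + 1) *
          ((j + 1 + 1) * (a' * (3125 * x) * (4 * z)))
        = (j + 2) * 12500 * ((4 * j + 1) * (4 * j + 2) * (4 * j + 3)) * 4 * (j + 1) * (j + 1) *
            x * z * ((j + 1) * a') := by ring
      _ = (j + 2) * (2 * (2 * j + 1)) * 12500 * ((4 * j + 1) * (4 * j + 2) * (4 * j + 3)) * 4 *
            (j + 1) * ((j + 1) * (a * x * z)) := by rw [h2]; ring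
      _ ≤ (j + 2) * (2 * (2 * j + 1)) * 12500 * ((4 * j + 1) * (4 * j + 2) * (4 * j + 3)) * 4 *
            (j + 1) * ((2 * j + 1) * (b * y)) := Nat.mul_le_mul le_rfl ih
      _ = (j + 2) * (2 * (2 * j + 1)) * 12500 * ((4 * j + 1) * (4 * j + 2) * (4 * j + 3)) * 4 *
            (2 * j + 1) * ((j + 1) * (b * y)) := by ring
      _ ≤ (2 * j + 3) * 4096 * ((5 * j + 1) * (5 * j + 2) * (5 * j + 3) * (5 * j + 4)) * 5 *
            (j + 1) * ((j + 1) * (b * y)) := Nat.mul_le_mul hpoly le_rfl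
      _ = (2 * j + 3) * (j + 1) * 4096 * y * ((5 * j + 1) * (5 * j + 2) * (5 * j + 3) *
            (5 * j + 4) * (5 * (j + 1)) * b) := by ring
      _ = _ := by rw [← h5]; ring

/-- The binomial law with parameters `2 * j` and `1 / 2` is pointwise at most twice the binomial law
with parameters `5 * j` and `1 / 5`, up to clearing denominators. The two laws have the same mean
`j`, and the former has the smaller variance. -/
theorem choose_fair_le_two_mul (j k : ℕ) :
    (2 * j).choose k * 5 ^ (5 * j) * 4 ^ k ≤ 2 * ((5 * j).choose k * 4 ^ (6 * j)) := by
  -- the ratio of both sides increases in `k` up to `k = j` and decreases from there on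
  have hmode : (2 * j).choose j * 5 ^ (5 * j) * 4 ^ j ≤ 2 * ((5 * j).choose j * 4 ^ (6 * j)) := by
    have := choose_mode_le j
    refine Nat.le_of_mul_le_mul_left (this.trans ?_) j.succ_pos
    calc (2 * j + 1) * ((5 * j).choose j * 4 ^ (6 * j))
        ≤ (2 * (j + 1)) * ((5 * j).choose j * 4 ^ (6 * j)) :=
          Nat.mul_le_mul_right _ (by omega)
      _ = (j + 1) * (2 * ((5 * j).choose j * 4 ^ (6 * j))) := by ring
  have hup : ∀ k, j ≤ k →
      (2 * j).choose k * 5 ^ (5 * j) * 4 ^ k ≤ 2 * ((5 * j).choose k * 4 ^ (6 * j)) := by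
    intro k hk
    induction k, hk using Nat.le_induction with
    | base => exact hmode
    | succ k hk ih =>
      rcases lt_or_ge k (2 * j) with hlt | hge
      · have h1 := Nat.choose_succ_right_eq (2 * j) k
        have h2 := Nat.choose_succ_right_eq (5 * j) k
        have h3 : 4 * (2 * j - k) ≤ 5 * j - k := by omega
        refine Nat.le_of_mul_le_mul_left (c := k + 1) ?_ (by omega)
        calc (k + 1) * ((2 * j).choose (k + 1) * 5 ^ (5 * j) * 4 ^ (k + 1))
            = ((2 * j).choose (k + 1) * (k + 1)) * 5 ^ (5 * j) * 4 ^ (k + 1) := by ring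
          _ = (4 * (2 * j - k)) * ((2 * j).choose k * 5 ^ (5 * j) * 4 ^ k) := by rw [h1]; ring
          _ ≤ (5 * j - k) * (2 * ((5 * j).choose k * 4 ^ (6 * j))) := Nat.mul_le_mul h3 ih
          _ = 2 * (((5 * j).choose k * (5 * j - k)) * 4 ^ (6 * j)) := by ring
          _ = (k + 1) * (2 * ((5 * j).choose (k + 1) * 4 ^ (6 * j))) := by rw [← h2]; ring
      · rw [Nat.choose_eq_zero_of_lt (show 2 * j < k + 1 by omega)]; simp
  have hdown : ∀ i, i ≤ j → (2 * j).choose (j - i) * 5 ^ (5 * j) * 4 ^ (j - i) ≤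
      2 * ((5 * j).choose (j - i) * 4 ^ (6 * j)) := by
    intro i hi
    induction i with
    | zero => exact hmode
    | succ i ih =>
      have ih := ih (by omega)
      obtain ⟨k, hk⟩ : ∃ k, k = j - (i + 1) := ⟨_, rfl⟩
      rw [← hk]
      rw [show j - i = k + 1 by omega] at ih
      have h1 := Nat.choose_succ_right_eq (2 * j) k
      have h2 := Nat.choose_succ_right_eq (5 * j) k
      have h3 : 5 * j - k ≤ 4 * (2 * j - k) := by omega
      refine Nat.le_of_mul_le_mul_left (c := 4 * (2 * j - k)) ?_ (by omega)
      calc 4 * (2 * j - k) * ((2 * j).choose k * 5 ^ (5 * j) * 4 ^ k)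
          = (k + 1) * ((2 * j).choose (k + 1) * 5 ^ (5 * j) * 4 ^ (k + 1)) := by
            rw [mul_comm (k + 1), mul_right_comm _ _ (k + 1), mul_right_comm _ _ (k + 1), h1]; ring
        _ ≤ (k + 1) * (2 * ((5 * j).choose (k + 1) * 4 ^ (6 * j))) := Nat.mul_le_mul le_rfl ih
        _ = 2 * (((5 * j).choose (k + 1) * (k + 1)) * 4 ^ (6 * j)) := by ring
        _ = (5 * j - k) * (2 * ((5 * j).choose k * 4 ^ (6 * j))) := by rw [h2]; ring
        _ ≤ 4 * (2 * j - k) * (2 * ((5 * j).choose k * 4 ^ (6 * j))) := Nat.mul_le_mul h3 le_rfl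
  rcases le_total j k with h | h
  · exact hup k h
  · simpa [Nat.sub_sub_self h] using hdown (j - k) (by omega)

/-! ### Independent draws -/

theorem indep_apply {R : Type*} {n : ℕ} (p : Fin n → PMF R) (f : Fin n → R) :
    indep p f = ∏ t, p t (f t) := rfl

theorem indep_pure {R : Type*} {n : ℕ} (f : Fin n → R) :
    indep (fun t => PMF.pure (f t)) = PMF.pure f := by
  classical
  ext g
  rw [indep_apply, PMF.pure_apply]
  simp only [PMF.pure_apply]
  split_ifs with h
  · simp [h]
  · obtain ⟨t, ht⟩ := Function.ne_iff.mp h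
    exact Finset.prod_eq_zero (Finset.mem_univ t) (if_neg ht)

/-- Drawing independent values and then, independently for each index, a further value depending on
the first one, amounts to independent two-step draws. -/
theorem indep_bind {S R : Type*} [Fintype S] {n : ℕ} (p : Fin n → PMF S)
    (q : Fin n → S → PMF R) :
    (indep p).bind (fun s => indep fun t => q t (s t)) = indep fun t => (p t).bind (q t) := by
  classical
  ext f
  simp only [PMF.bind_apply, indep_apply, tsum_fintype, ← Finset.prod_mul_distrib]
  rw [Finset.prod_univ_sum]
  simp

theorem indep_map {S R : Type*} [Fintype S] {n : ℕ} (p : Fin n → PMF S) (g : S → R) :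
    indep (fun t => (p t).map g) = (indep p).map fun s => g ∘ s := by
  change indep (fun t => (p t).bind (PMF.pure ∘ g)) = (indep p).bind _
  rw [← indep_bind]
  congr 1
  funext s
  exact indep_pure _

/-! ### Utilities and majority wishes through the law of the outcome -/

/-- The law of the chosen alternative in a given world and for a given type profile. -/
def outcomeLaw {T : ℕ} (E : Environment) (M : Mechanism.{u} T) (σ : M.Profile) (w : World)
    (θ : Fin T → AgentType) : PMF Choice :=
  (indep fun t => (E.signalLaw w).bind (σ t (θ t))).bind M.outcome

theorem play_apply {T : ℕ} (E : Environment) (Q : PMF (Fin T → AgentType)) (M : Mechanism.{u} T)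
    (σ : M.Profile) (w : World) (θ : Fin T → AgentType) (a : Choice) :
    play E Q M σ (w, θ, a) = E.worldPrior w * (Q θ * outcomeLaw E M σ w θ a) := by
  have key : play E Q M σ = E.worldPrior.bind fun w => Q.bind fun θ =>
      (outcomeLaw E M σ w θ).map fun a => (w, θ, a) := by
    unfold play outcomeLaw
    congr 1; funext w; congr 1; funext θ
    rw [← indep_bind, PMF.bind_bind, PMF.map_bind]
    congr 1; funext s
    rw [PMF.map_bind]
  rw [key, PMF.bind_apply, tsum_eq_single w, PMF.bind_apply, tsum_eq_single θ, PMF.map_apply,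
    tsum_eq_single a]
  · simp
  · intro b hb; simp [hb.symm]
  · intro θ' h; simp [PMF.map_apply, h.symm]
  · intro w' h; simp [PMF.bind_apply, PMF.map_apply, h.symm]

/-- The expected utility of an agent of type `k` given the type profile: the average over the
world and the chosen alternative. -/
def profileUtility {T : ℕ} (E : Environment) (M : Mechanism.{u} T) (σ : M.Profile) (k : AgentType)
    (θ : Fin T → AgentType) : ℝ :=
  ∑ w, ∑ a, (E.worldPrior w).toReal * (outcomeLaw E M σ w θ a).toReal * (E.v k w a : ℝ)

theorem utility_eq {T : ℕ} (E : Environment) (Q : PMF (Fin T → AgentType)) (M : Mechanism.{u} T)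
    (σ : M.Profile) (t : Fin T) (k : AgentType) :
    utility E Q M σ t k =
      (∑ θ : Fin T → AgentType, if θ t = k then (Q θ).toReal * profileUtility E M σ k θ else 0) /
        ∑ θ : Fin T → AgentType, if θ t = k then (Q θ).toReal else 0 := by
  unfold utility
  congr 1
  rw [Fintype.sum_prod_type, Finset.sum_congr rfl fun w _ => Fintype.sum_prod_type _,
    Finset.sum_comm]
  refine Finset.sum_congr rfl fun θ _ => ?_
  split_ifs with h
  · simp only [profileUtility, Finset.mul_sum, play_apply, ENNReal.toReal_mul]
    refine Finset.sum_congr rfl fun w _ => Finset.sum_congr rfl fun a _ => by ring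
  · simp

/-- If a deviation raises the expected utility by at least `c` at every type profile that is
possible given the own type, it raises the interim utility by at least `c`. -/
theorem utility_add_le {T : ℕ} {E : Environment} {Q : PMF (Fin T → AgentType)}
    {M : Mechanism.{u} T} {σ σ' : M.Profile} {t : Fin T} {k : AgentType} {c : ℝ}
    (h : ∀ θ, θ t = k → Q θ ≠ 0 → profileUtility E M σ k θ + c ≤ profileUtility E M σ' k θ)
    (hpos : ∃ θ, θ t = k ∧ Q θ ≠ 0) :
    utility E Q M σ t k + c ≤ utility E Q M σ' t k := by
  obtain ⟨θ₀, hθ₀, hQ₀⟩ := hpos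
  have hden : 0 < ∑ θ : Fin T → AgentType, if θ t = k then (Q θ).toReal else 0 := by
    refine Finset.sum_pos' (fun θ _ => by split_ifs <;> simp) ⟨θ₀, Finset.mem_univ _, ?_⟩
    rw [if_pos hθ₀]
    exact ENNReal.toReal_pos hQ₀ (PMF.apply_ne_top _ _)
  rw [utility_eq, utility_eq, div_add' _ _ _ hden.ne', div_le_div_iff_of_pos_right hden,
    Finset.mul_sum, ← Finset.sum_add_distrib]
  refine Finset.sum_le_sum fun θ _ => ?_
  split_ifs with hθ
  · rcases eq_or_ne (Q θ) 0 with hQ | hQ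
    · simp [hQ]
    · nlinarith [h θ hθ hQ, ENNReal.toReal_pos hQ (PMF.apply_ne_top _ _)]
  · simp

theorem utility_eq_zero {T : ℕ} {E : Environment} {Q : PMF (Fin T → AgentType)}
    {M : Mechanism.{u} T} {σ : M.Profile} {t : Fin T} {k : AgentType}
    (h : ∀ θ, θ t = k → Q θ = 0) : utility E Q M σ t k = 0 := by
  rw [utility_eq, Finset.sum_eq_zero, zero_div]
  intro θ _
  split_ifs with hθ <;> simp [h θ, *]

/-- Any family of outcomes that are not what the majority wants has small total probability when
the majority wish prevails with high probability. -/
theorem sum_play_lt_of_lt_majorityProb {T : ℕ} {E : Environment} {Q : PMF (Fin T → AgentType)}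
    {M : Mechanism.{u} T} {σ : M.Profile} {τ : ℝ} (h : 1 - τ < majorityProb E Q M σ)
    (s : Finset (World × (Fin T → AgentType) × Choice))
    (hs : ∀ x ∈ s, ¬ E.IsMajorityWish x.1 x.2.1 x.2.2) :
    ∑ x ∈ s, (play E Q M σ x).toReal < τ := by
  classical
  have htot : ∑ x, (play E Q M σ x).toReal = 1 := by
    rw [← ENNReal.toReal_sum fun x _ => PMF.apply_ne_top _ _,
      ← tsum_fintype (L := SummationFilter.unconditional _), PMF.tsum_coe, ENNReal.toReal_one]
  have hle : majorityProb E Q M σ + ∑ x ∈ s, (play E Q M σ x).toReal ≤ 1 := by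
    rw [← htot, majorityProb, ← Fintype.sum_ite_mem s, ← Finset.sum_add_distrib]
    refine Finset.sum_le_sum fun x _ => ?_
    by_cases hx : x ∈ s
    · simp [hx, hs x hx]
    · rw [if_neg hx, add_zero]
      split_ifs <;> simp
  linarith

/-! ### Symmetry and the number of high signals -/

theorem exists_perm_of_card_fiber_eq {n : ℕ} {β : Type*} [DecidableEq β] (f g : Fin n → β)
    (h : ∀ b, (Finset.univ.filter fun t => f t = b).card =
      (Finset.univ.filter fun t => g t = b).card) :
    ∃ π : Equiv.Perm (Fin n), f = g ∘ π := by
  have e : ∀ b, {t // f t = b} ≃ {t // g t = b} := fun b =>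
    Fintype.equivOfCardEq (by rw [Fintype.card_subtype, Fintype.card_subtype, h b])
  exact ⟨Equiv.ofFiberEquiv e, funext fun t => (Equiv.ofFiberEquiv_map e t).symm⟩

theorem sum_signal {β : Type*} [AddCommMonoid β] (f : Signal → β) : ∑ s, f s = f l + f h :=
  Finset.sum_pair (by decide)

theorem sum_world {β : Type*} [AddCommMonoid β] (f : World → β) : ∑ w, f w = f L + f H :=
  Finset.sum_pair (by decide)

theorem sum_choice {β : Type*} [AddCommMonoid β] (f : Choice → β) : ∑ a, f a = f A + f R :=
  Finset.sum_pair (by decide)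

/-- The number of high signals in a signal profile. -/
def highCount {n : ℕ} (s : Fin n → Signal) : ℕ :=
  (Finset.univ.filter fun t => s t = h).card

theorem exists_perm_of_highCount_eq {n : ℕ} {s s' : Fin n → Signal}
    (hs : highCount s = highCount s') : ∃ π : Equiv.Perm (Fin n), s = s' ∘ π := by
  refine exists_perm_of_card_fiber_eq s s' fun b => ?_
  cases b with
  | h => exact hs
  | l =>
    have key : ∀ u : Fin n → Signal,
        (Finset.univ.filter fun t => u t = l).card + highCount u = n := by
      intro u
      have hc : (Finset.univ.filter fun t => u t = h) = Finset.univ.filter fun t => ¬ u t = l :=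
        Finset.filter_congr fun t _ => by cases u t <;> decide
      rw [highCount, hc, Finset.card_filter_add_card_filter_not, Finset.card_univ, Fintype.card_fin]
    have h1 := key s
    have h2 := key s'
    omega

/-- If the agents in `S` draw independent signals from `q` and all the others hold a low signal,
then the number of high signals is binomially distributed. -/
theorem sum_indep_highCount {n : ℕ} (S : Finset (Fin n)) (q : PMF Signal) (G : ℕ → ℝ) :
    ∑ s, (indep (fun t => if t ∈ S then q else PMF.pure l) s).toReal * G (highCount s) =
      ∑ k ∈ Finset.range (S.card + 1),
        S.card.choose k * ((q h).toReal ^ k * (q l).toReal ^ (S.card - k) * G k) := by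
  have hk : ∀ A ∈ S.powerset, (q h).toReal ^ A.card * (q l).toReal ^ (S.card - A.card) * G A.card =
      (indep (fun t => if t ∈ S then q else PMF.pure l) fun t => if t ∈ A then h else l).toReal *
        G (highCount fun t => if t ∈ A then h else l) := by
    intro A hA
    rw [Finset.mem_powerset] at hA
    congr 1
    · rw [indep_apply, ENNReal.toReal_prod]
      have hprod : ∀ t, ((if t ∈ S then q else PMF.pure l) (if t ∈ A then h else l)).toReal =
          (if t ∈ A then (q h).toReal else 1) * (if t ∈ S \ A then (q l).toReal else 1) := by
        intro t
        by_cases h1 : t ∈ A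
        · simp [h1, hA h1]
        · by_cases h2 : t ∈ S <;> simp [h1, h2]
      simp_rw [hprod]
      rw [Finset.prod_mul_distrib, Fintype.prod_ite_mem, Fintype.prod_ite_mem, Finset.prod_const,
        Finset.prod_const, Finset.card_sdiff_of_subset hA]
    · congr 1
      rw [highCount]
      congr 1
      ext t
      by_cases h1 : t ∈ A <;> simp [h1]
  have := Finset.sum_powerset_apply_card
    (fun k => (q h).toReal ^ k * (q l).toReal ^ (S.card - k) * G k) (x := S)
  simp only [nsmul_eq_mul] at this
  rw [← this]
  symm
  refine Finset.sum_of_injOn (fun (A : Finset (Fin n)) t => if t ∈ A then h else l) ?_ ?_ ?_ hk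
  · intro A _ A' _ hAA
    ext t
    have := congrFun hAA t
    by_cases h1 : t ∈ A <;> by_cases h2 : t ∈ A' <;> simp_all
  · intro A _
    simp
  · intro s _ hs
    obtain ⟨t, ht, htS⟩ : ∃ t, s t = h ∧ t ∉ S := by
      by_contra! hcon
      refine hs ⟨Finset.univ.filter fun t => s t = h, ?_, ?_⟩
      · simpa [Set.subset_def] using hcon
      · funext t
        cases hst : s t <;> simp [hst]
    rw [indep_apply, Finset.prod_eq_zero (Finset.mem_univ t)]
    · simp
    · simp [ht, htS]

/-- Fair signals of two fifths of the agents, with low signals of all the others, produce no number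
of high signals more than twice as often as independent signals of all the agents which are high
with probability `1 / 5`. -/
theorem sum_indep_fair_le {n j : ℕ} (hn : n = 5 * j) (S : Finset (Fin n)) (hS : S.card = 2 * j)
    {p q : PMF Signal} (hph : (p h).toReal = 1 / 2) (hpl : (p l).toReal = 1 / 2)
    (hqh : (q h).toReal = 1 / 5) (hql : (q l).toReal = 4 / 5) {G : ℕ → ℝ} (hG : ∀ k, 0 ≤ G k) :
    ∑ s, (indep (fun t => if t ∈ S then p else PMF.pure l) s).toReal * G (highCount s) ≤
      2 * ∑ s, (indep (fun _ : Fin n => q) s).toReal * G (highCount s) := by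
  have huniv := sum_indep_highCount Finset.univ q G (n := n)
  simp only [Finset.mem_univ, if_true, Finset.card_univ, Fintype.card_fin] at huniv
  rw [huniv, sum_indep_highCount, hS, hph, hpl, hqh, hql, hn, Finset.mul_sum]
  refine (Finset.sum_le_sum_of_subset_of_nonneg (t := Finset.range (5 * j + 1))
    (by rw [Finset.range_subset_range]; omega) fun k _ _ => ?_).trans
      (Finset.sum_le_sum fun k hk => ?_)
  · have := hG k
    positivity
  · rw [Finset.mem_range] at hk
    rcases lt_or_ge (2 * j) k with hlt | hge
    · -- no more than `2 * j` agents can hold a high signal on the left-hand side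
      rw [Nat.choose_eq_zero_of_lt hlt]
      have := hG k
      simp only [Nat.cast_zero, zero_mul]
      positivity
    · have hnat : ((2 * j).choose k * 5 ^ (5 * j) * 4 ^ k : ℝ) ≤
          2 * ((5 * j).choose k * 4 ^ (6 * j)) := by
        exact_mod_cast choose_fair_le_two_mul j k
      have e1 : (1 / 2 : ℝ) ^ k * (1 / 2) ^ (2 * j - k) = 1 / 4 ^ j := by
        rw [← pow_add, Nat.add_sub_cancel' hge, pow_mul, ← one_div_pow]
        norm_num
      have e2 : (1 / 5 : ℝ) ^ k * (4 / 5) ^ (5 * j - k) = 4 ^ (5 * j) / (5 ^ (5 * j) * 4 ^ k) := by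
        rw [div_pow, div_pow, div_mul_div_comm, ← pow_add, Nat.add_sub_cancel' (by omega),
          eq_div_iff (by positivity), div_mul_eq_mul_div, div_eq_iff (by positivity), one_pow]
        calc _ = (4 ^ (5 * j - k) * 4 ^ k : ℝ) * 5 ^ (5 * j) := by ring
          _ = _ := by rw [← pow_add, Nat.sub_add_cancel (by omega)]
      have hratio : ((2 * j).choose k * (1 / 4 ^ j) : ℝ) ≤
          2 * ((5 * j).choose k * (4 ^ (5 * j) / (5 ^ (5 * j) * 4 ^ k))) := by
        rw [mul_one_div, mul_div_assoc', mul_div_assoc', div_le_div_iff₀ (by positivity)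
          (by positivity)]
        calc ((2 * j).choose k * (5 ^ (5 * j) * 4 ^ k) : ℝ)
            = (2 * j).choose k * 5 ^ (5 * j) * 4 ^ k := by ring
          _ ≤ _ := hnat
          _ = _ := by rw [show 6 * j = 5 * j + j by ring, pow_add]; ring
      rw [e1, e2]
      calc _ = ((2 * j).choose k * (1 / 4 ^ j) : ℝ) * G k := by ring
        _ ≤ _ := mul_le_mul_of_nonneg_right hratio (hG k)
        _ = _ := by ring

/-! ### The environment and its consistent priors -/

/-- The type fractions when two fifths of the agents are candidate-friendly and all the others are
contingent. -/
def mixedFractions : AgentType → ℝ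
  | F => 2 / 5
  | U => 0
  | C => 3 / 5

/-- The type fractions when all the agents are contingent. -/
def contingentFractions : AgentType → ℝ
  | F => 0
  | U => 0
  | C => 1

theorem sum_agentType {β : Type*} [AddCommMonoid β] (f : AgentType → β) :
    ∑ k, f k = f F + (f U + f C) := by
  change ∑ k ∈ ({F, U, C} : Finset AgentType), f k = _
  rw [Finset.sum_insert (by decide), Finset.sum_insert (by decide), Finset.sum_singleton]

theorem four_fifths_add_one_fifth : (4 / 5 + 1 / 5 : ℝ≥0∞) = 1 := by
  rw [ENNReal.div_add_div_same, show (4 + 1 : ℝ≥0∞) = 5 by norm_num]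
  exact ENNReal.div_self (by norm_num) (by norm_num)

/-- The prior over worlds: high quality has probability `1 / 5`. -/
def hardWorldPrior : PMF World :=
  PMF.ofFintype (fun | L => 4 / 5 | H => 1 / 5)
    (by rw [sum_world]; exact four_fifths_add_one_fifth)

/-- A signal that is high with probability `1 / 5`. -/
def rareHighSignal : PMF Signal :=
  PMF.ofFintype (fun | l => 4 / 5 | h => 1 / 5)
    (by rw [sum_signal]; exact four_fifths_add_one_fifth)

/-- The environment without good mechanisms. Low quality produces low signals only, so that high
signals occur only in the high-quality world. The type fractions are `mixedFractions` or
`contingentFractions`, with probability `1 / 2` each, so that a candidate-friendly agent can infer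
that they are mixed. For such an agent, a lost acceptance costs `3` in the high-quality world and
`1` in the low-quality one, but the latter is four times as likely. -/
def hardEnv : Environment where
  B := 3
  B_pos := by norm_num
  worldPrior := hardWorldPrior
  worldPrior_pos := by
    intro w
    cases w <;> simp [hardWorldPrior]
  signalLaw := fun | L => PMF.pure l | H => rareHighSignal
  corr_l := by
    have : (4 / 5 : ℝ≥0∞) < 1 := by
      rw [ENNReal.div_lt_iff (by norm_num) (by norm_num)]
      norm_num
    simpa [rareHighSignal] using this
  corr_h := by simp [rareHighSignal]
  typeLaw := (PMF.uniformOfFintype Bool).map fun b =>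
    cond b mixedFractions contingentFractions
  typeLaw_simplex := by
    intro α hα
    obtain ⟨b, -, rfl⟩ := (PMF.mem_support_map_iff _ _ _).mp hα
    constructor
    · intro k
      cases b <;> cases k <;> norm_num [mixedFractions, contingentFractions]
    · rw [sum_agentType]
      cases b <;> norm_num [mixedFractions, contingentFractions]
  v := fun
    | F, H, A => 3 | F, L, A => 2 | F, L, R => 1 | F, H, R => 0
    | U, L, R => 3 | U, H, R => 2 | U, H, A => 1 | U, L, A => 0
    | C, L, R => 1 | C, H, R => 0 | C, H, A => 1 | C, L, A => 0
  v_le := by decide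
  v_A := by decide
  v_R := by decide
  friendly := by decide
  unfriendly := by decide
  contingent := by decide

theorem mixedFractions_ne : mixedFractions ≠ contingentFractions := by
  intro hne
  have := congrFun hne F
  norm_num [mixedFractions, contingentFractions] at this

theorem card_type_eq {T : ℕ} (hT : T ≠ 0) {θ : Fin T → AgentType} {α : AgentType → ℝ}
    (hθ : typeFractions θ = α) (k : AgentType) :
    ((Finset.univ.filter fun t => θ t = k).card : ℝ) = α k * T := by
  rw [← hθ, typeFractions, div_mul_cancel₀ _ (by exact_mod_cast hT)]

theorem ne_zero_of_typeFractions {T : ℕ} {θ : Fin T → AgentType}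
    (hθ : typeFractions θ C ≠ 0) : T ≠ 0 := by
  rintro rfl
  simp [typeFractions] at hθ

theorem eq_contingent_of_typeFractions {T : ℕ} {θ : Fin T → AgentType}
    (hθ : typeFractions θ = contingentFractions) : θ = fun _ => C := by
  have hT : T ≠ 0 := ne_zero_of_typeFractions (θ := θ) (by rw [hθ]; norm_num [contingentFractions])
  have hC := card_type_eq hT hθ C
  rw [contingentFractions, one_mul] at hC
  have hC' : (Finset.univ.filter fun t => θ t = C).card = (Finset.univ : Finset (Fin T)).card := by
    rw [Finset.card_univ, Fintype.card_fin]
    exact_mod_cast hC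
  funext t
  exact Finset.card_filter_eq_iff.mp hC' t (Finset.mem_univ t)

/-- Mixed fractions are possible only if the number of agents is a multiple of five. -/
theorem exists_card_of_typeFractions {T : ℕ} {θ : Fin T → AgentType}
    (hθ : typeFractions θ = mixedFractions) :
    ∃ j, 0 < j ∧ T = 5 * j ∧ (Finset.univ.filter fun t => θ t = F).card = 2 * j ∧
      ∀ t, θ t ≠ U := by
  have hT : T ≠ 0 := ne_zero_of_typeFractions (θ := θ) (by rw [hθ]; norm_num [mixedFractions])
  have hF := card_type_eq hT hθ F
  have hU := card_type_eq hT hθ U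
  simp only [mixedFractions] at hF hU
  have hF' : 5 * (Finset.univ.filter fun t => θ t = F).card = 2 * T := by
    have : (5 * (Finset.univ.filter fun t => θ t = F).card : ℝ) = 2 * T := by linarith
    exact_mod_cast this
  refine ⟨T / 5, by omega, by omega, by omega, fun t ht => ?_⟩
  have hU' : (Finset.univ.filter fun t => θ t = U).card = 0 := by
    rw [zero_mul] at hU
    exact_mod_cast hU
  rw [Finset.card_eq_zero] at hU'
  exact Finset.notMem_empty t (hU' ▸ Finset.mem_filter.mpr ⟨Finset.mem_univ t, ht⟩)

theorem hardEnv_typeLaw_mixed : (hardEnv.typeLaw mixedFractions).toReal = 1 / 2 := by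
  classical
  simp [hardEnv, mixedFractions_ne]

theorem hardEnv_typeLaw_contingent : (hardEnv.typeLaw contingentFractions).toReal = 1 / 2 := by
  classical
  simp [hardEnv, mixedFractions_ne.symm]

open Classical in
theorem sum_prior_eq_typeLaw {E : Environment} {T : ℕ} {Q : PMF (Fin T → AgentType)}
    (hQ : E.IsTypePrior Q) (α : AgentType → ℝ) :
    ∑ θ ∈ Finset.univ.filter (fun θ => typeFractions θ = α), (Q θ).toReal =
      (E.typeLaw α).toReal := by
  rw [← ENNReal.toReal_sum fun θ _ => PMF.apply_ne_top _ _, ← hQ, PMF.map_apply, tsum_fintype,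
    Finset.sum_filter]
  congr! 3 with θ
  exact eq_comm

theorem typeFractions_of_prior_ne_zero {T : ℕ} {Q : PMF (Fin T → AgentType)}
    (hQ : hardEnv.IsTypePrior Q) {θ : Fin T → AgentType} (hθ : Q θ ≠ 0) :
    typeFractions θ = mixedFractions ∨ typeFractions θ = contingentFractions := by
  have hmem : typeFractions θ ∈ hardEnv.typeLaw.support := by
    rw [← hQ]
    exact (PMF.mem_support_map_iff _ _ _).mpr ⟨θ, hθ, rfl⟩
  obtain ⟨b, -, hb⟩ := (PMF.mem_support_map_iff _ _ _).mp hmem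
  cases b
  · exact Or.inr hb.symm
  · exact Or.inl hb.symm

theorem prior_contingent {T : ℕ} {Q : PMF (Fin T → AgentType)} (hQ : hardEnv.IsTypePrior Q) :
    (Q fun _ => C).toReal = 1 / 2 := by
  classical
  rw [← hardEnv_typeLaw_contingent, ← sum_prior_eq_typeLaw hQ]
  have hsub : Finset.univ.filter (fun θ : Fin T → AgentType =>
      typeFractions θ = contingentFractions) ⊆ {fun _ => C} := by
    intro θ hθ
    rw [Finset.mem_singleton]
    exact eq_contingent_of_typeFractions (Finset.mem_filter.mp hθ).2
  rcases Finset.subset_singleton_iff.mp hsub with hem | hsing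
  · have := sum_prior_eq_typeLaw hQ contingentFractions
    rw [hem, hardEnv_typeLaw_contingent] at this
    norm_num at this
  · rw [hsing, Finset.sum_singleton]

theorem exists_mixed {T : ℕ} {Q : PMF (Fin T → AgentType)} (hQ : hardEnv.IsTypePrior Q) :
    ∃ θ, typeFractions θ = mixedFractions ∧ Q θ ≠ 0 := by
  classical
  have hsum := sum_prior_eq_typeLaw hQ mixedFractions
  rw [hardEnv_typeLaw_mixed] at hsum
  obtain ⟨θ, hθ, hne⟩ := Finset.exists_ne_zero_of_sum_ne_zero (hsum.trans_ne (by norm_num))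
  exact ⟨θ, (Finset.mem_filter.mp hθ).2, fun h0 => hne (by simp [h0])⟩

theorem exists_typePrior {j : ℕ} (hj : 0 < j) :
    ∃ Q : PMF (Fin (5 * j) → AgentType), hardEnv.IsTypePrior Q := by
  refine ⟨(PMF.uniformOfFintype Bool).map fun b t => cond b (if t.val < 2 * j then F else C) C, ?_⟩
  rw [Environment.IsTypePrior, PMF.map_comp, hardEnv]
  -- both laws are images of the same coin, so that only the fractions have to be computed
  congr 1
  have hj' : (j : ℝ) ≠ 0 := by exact_mod_cast hj.ne'
  have hlt : (Finset.univ.filter fun t : Fin (5 * j) => t.val < 2 * j).card = 2 * j := by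
    rw [Fin.card_filter_val_lt]
    omega
  have hge : (Finset.univ.filter fun t : Fin (5 * j) => ¬ t.val < 2 * j).card = 3 * j := by
    have := Finset.card_filter_add_card_filter_not
      (s := (Finset.univ : Finset (Fin (5 * j)))) (fun t => t.val < 2 * j)
    rw [hlt, Finset.card_univ, Fintype.card_fin] at this
    omega
  funext b k
  cases b
  · cases k <;> simp [typeFractions, contingentFractions, hj']
  · cases k
    · have : ∀ t : Fin (5 * j), (if t.val < 2 * j then F else C) = F ↔ t.val < 2 * j := by
        intro t; split_ifs <;> simp [*]
      simp only [Function.comp_apply, typeFractions, cond_true, this, hlt, mixedFractions]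
      push_cast
      field_simp
    · have : ∀ t : Fin (5 * j), ¬ (if t.val < 2 * j then F else C) = U := by
        intro t; split_ifs <;> simp
      simp [typeFractions, mixedFractions, this]
    · have : ∀ t : Fin (5 * j), (if t.val < 2 * j then F else C) = C ↔ ¬ t.val < 2 * j := by
        intro t; split_ifs <;> simp [*]
      simp only [Function.comp_apply, typeFractions, cond_true, this, hge, mixedFractions]
      push_cast
      field_simp

/-! ### Mimicry by the candidate-friendly agents -/

/-- The truthful report of an agent of type `k` with signal `s`. -/
def truthfulReport {T : ℕ} (M : Mechanism.{u} T) (E : Environment)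
    (Q : PMF (Fin T → AgentType)) (k : AgentType) (s : Signal) : M.Report :=
  fun q => M.correct q ⟨E, Q, k, s⟩

instance : Nonempty Signal := ⟨l⟩

/-- Every candidate-friendly agent pretends to be contingent and to hold a signal obtained from a
fair coin; all the other types remain truthful. -/
def mimicry {T : ℕ} (M : Mechanism.{u} T) (E : Environment)
    (Q : PMF (Fin T → AgentType)) : M.Profile :=
  fun t k s => if k = F then (PMF.uniformOfFintype Signal).map (truthfulReport M E Q C)
    else M.truthful E Q t k s

theorem outcomeLaw_truthful_low {T : ℕ} (Q : PMF (Fin T → AgentType)) (M : Mechanism.{u} T)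
    (θ : Fin T → AgentType) :
    outcomeLaw hardEnv M (M.truthful hardEnv Q) L θ =
      M.outcome fun t => truthfulReport M hardEnv Q (θ t) l := by
  have : ∀ t, (hardEnv.signalLaw L).bind (M.truthful hardEnv Q t (θ t)) =
      PMF.pure (truthfulReport M hardEnv Q (θ t) l) := fun t => PMF.pure_bind _ _
  rw [outcomeLaw]
  simp_rw [this]
  rw [indep_pure, PMF.pure_bind]

theorem outcomeLaw_truthful_contingent {T : ℕ} (E : Environment) (Q : PMF (Fin T → AgentType))
    (M : Mechanism.{u} T) (w : World) :
    outcomeLaw E M (M.truthful E Q) w (fun _ => C) =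
      (indep fun _ : Fin T => E.signalLaw w).bind fun s =>
        M.outcome (truthfulReport M E Q C ∘ s) := by
  change (indep fun t => (E.signalLaw w).map (truthfulReport M E Q C)).bind M.outcome = _
  rw [indep_map, PMF.bind_map]
  rfl

theorem outcomeLaw_mimicry_low {T : ℕ} (Q : PMF (Fin T → AgentType)) (M : Mechanism.{u} T)
    {θ : Fin T → AgentType} (hθ : ∀ t, θ t ≠ U) :
    outcomeLaw hardEnv M (mimicry M hardEnv Q) L θ =
      (indep fun t => if t ∈ Finset.univ.filter (fun t => θ t = F) then
        PMF.uniformOfFintype Signal else PMF.pure l).bind fun s =>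
          M.outcome (truthfulReport M hardEnv Q C ∘ s) := by
  have : ∀ t, (hardEnv.signalLaw L).bind (mimicry M hardEnv Q t (θ t)) =
      (if t ∈ Finset.univ.filter (fun t => θ t = F) then
        PMF.uniformOfFintype Signal else PMF.pure l).map (truthfulReport M hardEnv Q C) := by
    intro t
    change (PMF.pure l).bind _ = _
    rw [PMF.pure_bind]
    cases hk : θ t with
    | F => simp [mimicry, hk]
    | U => exact absurd hk (hθ t)
    | C =>
      simp only [mimicry, reduceCtorEq, if_false, Finset.mem_filter, hk, and_false, PMF.pure_map]
      rfl
  rw [outcomeLaw]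
  simp_rw [this]
  rw [indep_map, PMF.bind_map]
  rfl

theorem toReal_bind_apply {S β : Type*} [Fintype S] (p : PMF S) (f : S → PMF β) (b : β) :
    (p.bind f b).toReal = ∑ s, (p s).toReal * (f s b).toReal := by
  rw [PMF.bind_apply, tsum_fintype, ENNReal.toReal_sum fun s _ =>
    ENNReal.mul_ne_top (PMF.apply_ne_top _ _) (PMF.apply_ne_top _ _)]
  simp only [ENNReal.toReal_mul]

/-- An anonymous mechanism reacts to reports derived from signals only through the number of high
signals. -/
theorem Mechanism.Anonymous.exists_highCount {T : ℕ} {M : Mechanism.{u} T} (hM : M.Anonymous)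
    (ρ : Signal → M.Report) (a : Choice) :
    ∃ G : ℕ → ℝ, (∀ k, 0 ≤ G k) ∧
      ∀ s : Fin T → Signal, (M.outcome (ρ ∘ s) a).toReal = G (highCount s) := by
  classical
  refine ⟨fun k => if hk : ∃ s : Fin T → Signal, highCount s = k then
    (M.outcome (ρ ∘ hk.choose) a).toReal else 0, fun k => ?_, fun s => ?_⟩
  · dsimp only
    split_ifs <;> simp
  · have hk : ∃ s' : Fin T → Signal, highCount s' = highCount s := ⟨s, rfl⟩
    dsimp only
    rw [dif_pos hk]
    obtain ⟨π, hπ⟩ := exists_perm_of_highCount_eq hk.choose_spec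
    rw [hM (ρ ∘ hk.choose) (ρ ∘ s) ⟨π, by rw [Function.comp_assoc, ← hπ]⟩]

theorem toReal_add_eq_one (p : PMF Choice) : (p A).toReal + (p R).toReal = 1 := by
  rw [← ENNReal.toReal_add (PMF.apply_ne_top _ _) (PMF.apply_ne_top _ _), ← sum_choice,
    ← tsum_fintype (L := SummationFilter.unconditional _), PMF.tsum_coe, ENNReal.toReal_one]

theorem worldPrior_L : (hardEnv.worldPrior L).toReal = 4 / 5 := by
  simp [hardEnv, hardWorldPrior]

theorem worldPrior_H : (hardEnv.worldPrior H).toReal = 1 / 5 := by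
  simp [hardEnv, hardWorldPrior]

theorem profileUtility_friendly {T : ℕ} (M : Mechanism.{u} T) (σ : M.Profile)
    (θ : Fin T → AgentType) :
    profileUtility hardEnv M σ F θ =
      4 / 5 * (1 + (outcomeLaw hardEnv M σ L θ A).toReal) +
        3 / 5 * (outcomeLaw hardEnv M σ H θ A).toReal := by
  have h1 := toReal_add_eq_one (outcomeLaw hardEnv M σ L θ)
  rw [profileUtility, sum_world, sum_choice, sum_choice, worldPrior_L, worldPrior_H]
  simp only [hardEnv] at h1 ⊢
  push_cast
  linear_combination (4 / 5) * h1

/-- Type profiles with the same mixed fractions are permutations of one another, so that an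
anonymous mechanism treats their truthful reports in the low-quality world alike. -/
theorem outcomeLaw_truthful_low_congr {T : ℕ} (Q : PMF (Fin T → AgentType)) {M : Mechanism.{u} T}
    (hM : M.Anonymous) {θ θ' : Fin T → AgentType} (hθ : typeFractions θ = mixedFractions)
    (hθ' : typeFractions θ' = mixedFractions) :
    outcomeLaw hardEnv M (M.truthful hardEnv Q) L θ =
      outcomeLaw hardEnv M (M.truthful hardEnv Q) L θ' := by
  obtain ⟨j, hj, hT, -⟩ := exists_card_of_typeFractions hθ
  have hT0 : T ≠ 0 := by omega
  obtain ⟨π, hπ⟩ := exists_perm_of_card_fiber_eq θ θ' fun k => by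
    have := (card_type_eq hT0 hθ k).trans (card_type_eq hT0 hθ' k).symm
    exact_mod_cast this
  rw [outcomeLaw_truthful_low, outcomeLaw_truthful_low]
  exact hM _ _ ⟨π, by subst hπ; rfl⟩

/-- If the majority wish prevails with high probability, then acceptance is rare in the low-quality
world with mixed fractions: that world and those fractions meet with probability
`4 / 5 * (1 / 2) = 2 / 5`. -/
theorem accept_lt_of_lt_majorityProb {T : ℕ} {Q : PMF (Fin T → AgentType)}
    (hQ : hardEnv.IsTypePrior Q) {M : Mechanism.{u} T} (hM : M.Anonymous) {τ : ℝ}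
    (hτ : 1 - τ < majorityProb hardEnv Q M (M.truthful hardEnv Q)) {θ₀ : Fin T → AgentType}
    (hθ₀ : typeFractions θ₀ = mixedFractions) :
    2 / 5 * (outcomeLaw hardEnv M (M.truthful hardEnv Q) L θ₀ A).toReal < τ := by
  classical
  have hlt := sum_play_lt_of_lt_majorityProb hτ
    ((Finset.univ.filter fun θ : Fin T → AgentType => typeFractions θ = mixedFractions).image
      fun θ => (L, θ, A)) (by
      intro x hx hmaj
      obtain ⟨θ, hθ, rfl⟩ := Finset.mem_image.mp hx
      obtain ⟨j, hj, hT, hF, -⟩ := exists_card_of_typeFractions (Finset.mem_filter.mp hθ).2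
      have hsub : (Finset.univ.filter fun t => ∀ b, b ≠ A →
          hardEnv.v (θ t) L b < hardEnv.v (θ t) L A) ⊆
            Finset.univ.filter fun t => θ t = F := by
        intro t ht
        have hR := (Finset.mem_filter.mp ht).2 R (by decide)
        refine Finset.mem_filter.mpr ⟨Finset.mem_univ t, ?_⟩
        revert hR
        cases θ t <;> simp [hardEnv]
      have hcard := Finset.card_le_card hsub
      rw [Environment.IsMajorityWish] at hmaj
      dsimp only at hmaj
      omega)
  rw [Finset.sum_image fun θ _ θ' _ hθθ => by simpa using hθθ] at hlt
  have hsum := sum_prior_eq_typeLaw hQ mixedFractions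
  rw [hardEnv_typeLaw_mixed] at hsum
  have hrw : ∀ θ ∈ Finset.univ.filter (fun θ : Fin T → AgentType =>
      typeFractions θ = mixedFractions),
      (play hardEnv Q M (M.truthful hardEnv Q) (L, θ, A)).toReal =
        (Q θ).toReal *
          (4 / 5 * (outcomeLaw hardEnv M (M.truthful hardEnv Q) L θ₀ A).toReal) := by
    intro θ hθ
    rw [play_apply, ENNReal.toReal_mul, ENNReal.toReal_mul, worldPrior_L,
      outcomeLaw_truthful_low_congr Q hM (Finset.mem_filter.mp hθ).2 hθ₀]
    ring
  rw [Finset.sum_congr rfl hrw, ← Finset.sum_mul, hsum] at hlt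
  linarith

/-- If the majority wish prevails with high probability, then rejection is rare in the high-quality
world when all the agents are contingent: both happen with probability
`1 / 5 * (1 / 2) = 1 / 10`. -/
theorem reject_lt_of_lt_majorityProb {T : ℕ} {Q : PMF (Fin T → AgentType)}
    (hQ : hardEnv.IsTypePrior Q) {M : Mechanism.{u} T} {τ : ℝ}
    (hτ : 1 - τ < majorityProb hardEnv Q M (M.truthful hardEnv Q)) :
    1 / 10 * (outcomeLaw hardEnv M (M.truthful hardEnv Q) H (fun _ => C) R).toReal < τ := by
  have hlt := sum_play_lt_of_lt_majorityProb hτ {(H, fun _ => C, R)} (by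
    intro x hx hmaj
    rw [Finset.mem_singleton] at hx
    subst hx
    have hempty : (Finset.univ.filter fun _ : Fin T => ∀ b, b ≠ R →
        hardEnv.v C H b < hardEnv.v C H R) = ∅ :=
      Finset.filter_false_of_mem fun t _ hb => by simpa [hardEnv] using hb A (by decide)
    rw [Environment.IsMajorityWish] at hmaj
    dsimp only at hmaj
    rw [hempty] at hmaj
    simp at hmaj)
  rw [Finset.sum_singleton, play_apply, ENNReal.toReal_mul, ENNReal.toReal_mul, worldPrior_H,
    prior_contingent hQ] at hlt
  linarith

/-- With mixed fractions in the low-quality world, mimicry leads to rejection at most twice as often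
as truthful contingent agents do in the high-quality world. -/
theorem reject_mimicry_le {T : ℕ} (Q : PMF (Fin T → AgentType)) {M : Mechanism.{u} T}
    (hM : M.Anonymous) {θ : Fin T → AgentType} (hθ : typeFractions θ = mixedFractions) :
    (outcomeLaw hardEnv M (mimicry M hardEnv Q) L θ R).toReal ≤
      2 * (outcomeLaw hardEnv M (M.truthful hardEnv Q) H (fun _ => C) R).toReal := by
  obtain ⟨j, -, hT, hF, hU⟩ := exists_card_of_typeFractions hθ
  obtain ⟨G, hG, hMG⟩ := hM.exists_highCount (truthfulReport M hardEnv Q C) R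
  have hcard : Fintype.card Signal = 2 := rfl
  rw [outcomeLaw_mimicry_low Q M hU, outcomeLaw_truthful_contingent, toReal_bind_apply,
    toReal_bind_apply]
  simp only [hMG]
  refine sum_indep_fair_le hT _ hF ?_ ?_ ?_ ?_ hG
  · simp [hcard]
  · simp [hcard]
  · simp [hardEnv, rareHighSignal]
  · simp [hardEnv, rareHighSignal]

/-- If the majority wish prevails with high probability, then mimicry is a profitable joint
deviation of all the candidate-friendly agents. -/
theorem not_good_mechanism {T : ℕ} {Q : PMF (Fin T → AgentType)} (hQ : hardEnv.IsTypePrior Q)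
    {M : Mechanism.{u} T} (hM : M.Anonymous)
    (hmaj : 1 - 1 / 1000 < majorityProb hardEnv Q M (M.truthful hardEnv Q)) :
    ¬ IsStrongBNE hardEnv Q M (1 / 1000) (M.truthful hardEnv Q) := by
  have hH := reject_lt_of_lt_majorityProb hQ hmaj
  -- In the low-quality world the probability of acceptance rises from below `1 / 400` to above
  -- `1 - 2 / 100`, which is worth almost `4 / 5`; the loss in the other world is at most `3 / 5`.
  have hgain : ∀ t θ, θ t = F → Q θ ≠ 0 →
      profileUtility hardEnv M (M.truthful hardEnv Q) F θ + 1 / 10 ≤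
        profileUtility hardEnv M (mimicry M hardEnv Q) F θ := by
    intro t θ ht hθQ
    have hθ : typeFractions θ = mixedFractions := by
      refine (typeFractions_of_prior_ne_zero hQ hθQ).resolve_right fun hc => ?_
      rw [eq_contingent_of_typeFractions hc] at ht
      cases ht
    have h1 := accept_lt_of_lt_majorityProb hQ hM hmaj hθ
    have h2 := reject_mimicry_le Q hM hθ
    have h3 := toReal_add_eq_one (outcomeLaw hardEnv M (mimicry M hardEnv Q) L θ)
    have h4 := toReal_add_eq_one (outcomeLaw hardEnv M (M.truthful hardEnv Q) H θ)
    have h5 : 0 ≤ (outcomeLaw hardEnv M (M.truthful hardEnv Q) H θ R).toReal :=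
      ENNReal.toReal_nonneg
    have h6 : 0 ≤ (outcomeLaw hardEnv M (mimicry M hardEnv Q) H θ A).toReal :=
      ENNReal.toReal_nonneg
    rw [profileUtility_friendly, profileUtility_friendly]
    linarith
  rw [IsStrongBNE, not_not]
  refine ⟨{x | x.2 = F}, mimicry M hardEnv Q, ?_, ?_, ?_⟩
  · intro t k hk
    funext s
    exact if_neg hk
  · rintro t k rfl
    -- the prior may exclude that agent `t` is candidate-friendly; then both utilities are zero
    by_cases hpos : ∃ θ, θ t = F ∧ Q θ ≠ 0
    · linarith [utility_add_le (hgain t) hpos]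
    · push Not at hpos
      rw [utility_eq_zero hpos, utility_eq_zero hpos]
  · obtain ⟨θ, hθ, hθQ⟩ := exists_mixed hQ
    obtain ⟨j, hj, -, hF, -⟩ := exists_card_of_typeFractions hθ
    obtain ⟨t, ht⟩ : (Finset.univ.filter fun t => θ t = F).Nonempty := by
      rw [← Finset.card_pos]
      omega
    exact ⟨t, F, rfl, by
      linarith [utility_add_le (hgain t) ⟨θ, (Finset.mem_filter.mp ht).2, hθQ⟩]⟩

end CrowdVoting

end

open CrowdVoting
theorem mainTheorem4 :
    ∃ τ : ℝ, 0 < τ ∧ ∃ E : Environment,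
      (∃ᶠ T : ℕ in atTop, Odd T ∧ ∃ Q : PMF (Fin T → AgentType), E.IsTypePrior Q) ∧
      ∀ T : ℕ, Odd T → ∀ Q : PMF (Fin T → AgentType), E.IsTypePrior Q →
        ∀ M : Mechanism.{u} T, M.Anonymous →
          ¬ (1 - τ < majorityProb E Q M (M.truthful E Q) ∧
              IsStrongBNE E Q M τ (M.truthful E Q)) := by
  refine ⟨1 / 1000, by norm_num, hardEnv, ?_, ?_⟩
  · rw [frequently_atTop]
    intro N
    exact ⟨5 * (2 * N + 1), by omega, by simp [Nat.odd_iff],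
      exists_typePrior (by omega)⟩
  · rintro T - Q hQ M hM ⟨hmaj, hBNE⟩
    exact not_good_mechanism hQ hM hmaj hBNE
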